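/- All digraphs are finite, with a nonempty vertex set, and have no loops and no multiple arcs. For vertex-disjoint digraphs $G_1=(V_1,E_1)$ and $G_2=(V_2,E_2)$, the disjoint union $G_1\oplus G_2$ is $(V_1\cup V_2,\,E_1\cup E_2)$ and the order composition $G_1\oslash G_2$ is $(V_1\cup V_2,\,E_1\cup E_2\cup\{(u,v) : u\in V_1, v\in V_2\})$. A digraph is \emph{transitive} if for all arcs $(u,v),(v,w)$ with $u\neq w$ the pair $(u,w)$ is also an arc. A \emph{transitive tournament} is a transitive digraph in which any two distinct vertices are joined by exactly one arc. The \emph{oriented co-graphs} form the smallest isomorphism-closed class that contains the one-vertex digraph and is closed under $\oplus$ and $\oslash$. The \emph{oriented co-weakly quasi threshold graphs} form the smallest isomorphism-closed class that contains every transitive tournament and contains, with each $G$ in the class and each transitive tournament $T$, the digraphs $G\oslash T$, $T\oslash G$ and $G\oplus T$. A digraph is in $\mathrm{Free}(F)$ if none of its induced subdigraphs is isomorphic to a member of $F$. Define the following digraphs by their arcs: $D_1$: $a\to b\to c$ (directed path on three vertices); $D_5$: $a\to b\to c\to a$ (directed triangle); $D_8$: $a\to b\leftarrow c\to d$ (four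 vertices); $\overleftrightarrow{K_2}$: $a\to b$ and $b\to a$; $D_{12}$: all four arcs from $\{a,b\}$ to $\{c,d\}$ (four vertices); $D_{21}$: two disjoint copies of $X_1$; $D_{22}$: two disjoint copies of $X_2$; $D_{23}$: the disjoint union of $X_1$ and $X_2$, where $X_1$ is $a\to b\leftarrow c$ and $X_2$ is $a\leftarrow b\to c$. Theorem. For every digraph $G$ the following are equivalent: 1. $G$ is an oriented co-weakly quasi threshold graph. 2. $G\in\mathrm{Free}(\{D_1,D_5,D_8,\overleftrightarrow{K_2},D_{12},D_{21},D_{22},D_{23}\})$. 3. $G$ is an oriented co-graph and $G\in\mathrm{Free}(\{D_{12},D_{21},D_{22},D_{23}\})$. 4. $G\in\mathrm{Free}(\{D_8,\overleftrightarrow{K_2},D_{12},D_{21},D_{22},D_{23}\})$ and $G$ is transitive. -/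

import Mathlib

/-!
Digraphs are Mathlib's `Digraph V`. A digraph in the sense of this development is finite and has
no loops; both conditions are hypotheses of the theorem.
-/

universe u v

namespace Digraph

section Operations

variable {V : Type u} {W : Type v}

/-- The disjoint union `G ⊕ H`: no arcs between the two sides. -/
def disjUnion (G : Digraph V) (H : Digraph W) : Digraph (V ⊕ W) where
  Adj := Sum.LiftRel G.Adj H.Adj

/-- The order composition `G ⊘ H`: the disjoint union together with all arcs from the vertices
of `G` to the vertices of `H`. -/
def orderComp (G : Digraph V) (H : Digraph W) : Digraph (V ⊕ W) where
  Adj := Sum.Lex G.Adj H.Adj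

/-- Two digraphs are isomorphic. -/
def IsIso (G : Digraph V) (H : Digraph W) : Prop :=
  Nonempty (G.Adj ≃r H.Adj)

/-- `H` is isomorphic to an induced subdigraph of `G`: an injective map of the vertices
that preserves and reflects arcs. -/
def IsInducedIn (H : Digraph W) (G : Digraph V) : Prop :=
  Nonempty (H.Adj ↪r G.Adj)

/-- No loops. -/
def Loopless (G : Digraph V) : Prop :=
  ∀ x, ¬ G.Adj x x

/-- Whenever `(x, y)` and `(y, z)` are arcs with `x ≠ z`, so is `(x, z)`. -/
def IsTransitive (G : Digraph V) : Prop :=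
  ∀ x y z, G.Adj x y → G.Adj y z → x ≠ z → G.Adj x z

/-- Loopless, and exactly one of the arcs `(x, y)`, `(y, x)` for any two distinct vertices. -/
def IsTournament (G : Digraph V) : Prop :=
  G.Loopless ∧ ∀ x y, x ≠ y → (G.Adj x y ↔ ¬ G.Adj y x)

/-- A transitive tournament on a finite nonempty vertex set. -/
def IsTransitiveTournament (G : Digraph V) : Prop :=
  Finite V ∧ Nonempty V ∧ G.IsTournament ∧ G.IsTransitive

end Operations

/-- Oriented co-graphs: built from single vertices by disjoint union and order composition
(up to isomorphism). -/
inductive IsOrientedCograph : {V : Type u} → Digraph V → Prop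
  | single {V : Type u} [Unique V] : IsOrientedCograph (⊥ : Digraph V)
  | disjUnion {V W : Type u} {G : Digraph V} {H : Digraph W} :
      IsOrientedCograph G → IsOrientedCograph H → IsOrientedCograph (G.disjUnion H)
  | orderComp {V W : Type u} {G : Digraph V} {H : Digraph W} :
      IsOrientedCograph G → IsOrientedCograph H → IsOrientedCograph (G.orderComp H)
  | ofIso {V W : Type u} {G : Digraph V} {H : Digraph W} :
      IsOrientedCograph G → G.IsIso H → IsOrientedCograph H

/-- Oriented co-weakly quasi threshold graphs: built from transitive tournaments by
`G ⊘ T`, `T ⊘ G` and `G ⊕ T` with `T` a transitive tournament (up to isomorphism). -/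
inductive IsOrientedCoWeaklyQuasiThreshold : {V : Type u} → Digraph V → Prop
  | tournament {V : Type u} {T : Digraph V} :
      T.IsTransitiveTournament → IsOrientedCoWeaklyQuasiThreshold T
  | orderComp_right {V W : Type u} {G : Digraph V} {T : Digraph W} :
      IsOrientedCoWeaklyQuasiThreshold G → T.IsTransitiveTournament →
        IsOrientedCoWeaklyQuasiThreshold (G.orderComp T)
  | orderComp_left {V W : Type u} {G : Digraph V} {T : Digraph W} :
      IsOrientedCoWeaklyQuasiThreshold G → T.IsTransitiveTournament →
        IsOrientedCoWeaklyQuasiThreshold (T.orderComp G)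
  | disjUnion {V W : Type u} {G : Digraph V} {T : Digraph W} :
      IsOrientedCoWeaklyQuasiThreshold G → T.IsTransitiveTournament →
        IsOrientedCoWeaklyQuasiThreshold (G.disjUnion T)
  | ofIso {V W : Type u} {G : Digraph V} {H : Digraph W} :
      IsOrientedCoWeaklyQuasiThreshold G → G.IsIso H → IsOrientedCoWeaklyQuasiThreshold H

/-- A digraph on the vertex set `{0, …, n - 1}` for some `n`. -/
abbrev OnFin : Type := Σ n : ℕ, Digraph (Fin n)

/-- The digraph on `{0, …, n - 1}` with the listed arcs. -/
def ofArcs (n : ℕ) (A : List (Fin n × Fin n)) : OnFin :=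
  ⟨n, ⟨fun x y => (x, y) ∈ A⟩⟩

/-- `G ∈ Free F`: no induced subdigraph of `G` is isomorphic to a member of `F`. -/
def IsFree {V : Type u} (G : Digraph V) (F : Set OnFin) : Prop :=
  ∀ H ∈ F, ¬ H.2.IsInducedIn G

/-- The directed path on three vertices. -/
def D₁ : OnFin := ofArcs 3 [(0, 1), (1, 2)]

/-- The directed cycle on three vertices. -/
def D₅ : OnFin := ofArcs 3 [(0, 1), (1, 2), (2, 0)]

/-- The transitive orientation of the path on four vertices. -/
def D₈ : OnFin := ofArcs 4 [(0, 1), (2, 1), (2, 3)]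

/-- The bidirectional complete digraph on two vertices. -/
def biK₂ : OnFin := ofArcs 2 [(0, 1), (1, 0)]

/-- The transitive orientation of the cycle on four vertices: all arcs from `{0, 1}` to
`{2, 3}`. -/
def D₁₂ : OnFin := ofArcs 4 [(0, 2), (0, 3), (1, 2), (1, 3)]

/-- Two disjoint copies of `• → • ← •`. -/
def D₂₁ : OnFin := ofArcs 6 [(0, 1), (2, 1), (3, 4), (5, 4)]

/-- Two disjoint copies of `• ← • → •`. -/
def D₂₂ : OnFin := ofArcs 6 [(1, 0), (1, 2), (4, 3), (4, 5)]

/-- The disjoint union of `• ← • → •` and `• → • ← •`. -/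
def D₂₃ : OnFin := ofArcs 6 [(1, 0), (1, 2), (3, 4), (5, 4)]

end Digraph

/-! All four conditions amount to one: the arcs form a strict partial order satisfying `NFree`,
`CrossFree` and `CherriesMeet`. Once two-way arcs are excluded, avoiding `D₁` and `D₅` is the same
as transitivity, and the remaining forbidden digraphs translate one by one, with `D₂₁`, `D₂₂`, `D₂₃`
jointly giving `CherriesMeet`.

The comparability graph of an order without an induced N has no induced path on four vertices, so it
or its complement is disconnected (`PathFree.splitsOn`). Hence such an order is a disjoint union or
an order composition of smaller ones (`IsStrict.exists_split`), which yields the oriented co-graphs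
by induction.

The other two conditions force a tournament to split off at each stage. In an order composition,
incomparable pairs in both factors would form `D₁₂`, so one factor is a chain. In a disjoint union,
one side has no cherry; comparability is transitive there, that side is a union of chains, and one
chain splits off (`IsStrict.exists_total_part`). Conversely, the constructions with tournaments
preserve all the conditions. -/

namespace Digraph

/-! ### Splitting graphs without an induced path on four vertices -/

section Split

variable {V : Type*}

/-- The finite set `S` has a bipartition into nonempty parts with `r` holding across. -/
def SplitsOn (r : V → V → Prop) (S : Finset V) : Prop :=
  ∃ p : V → Prop, (∃ a ∈ S, p a) ∧ (∃ b ∈ S, ¬ p b) ∧ ∀ a ∈ S, ∀ b ∈ S, p a → ¬ p b → r a b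

/-- No four vertices induce a path in the symmetric relation `r`. -/
def PathFree (r : V → V → Prop) : Prop :=
  ∀ a b c d, a ≠ b → a ≠ c → a ≠ d → b ≠ c → b ≠ d → c ≠ d →
    r a b → r b c → r c d → r a c ∨ r a d ∨ r b d

/-- The path on four vertices is self-complementary: the complement of the path `a b c d` is the
path `b d a c`. -/
theorem PathFree.compl {r : V → V → Prop} (hs : ∀ a b, r a b → r b a) (h : PathFree r) :
    PathFree (fun a b => ¬ r a b) := by
  intro a b c d h1 h2 h3 h4 h5 h6 hab hbc hcd
  have := h b d a c h5 h1.symm h4 h3.symm h6.symm h2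
  grind

/-- If `v` is joined to all of `S`, it splits off in `r`. Otherwise it misses some vertex on one
side of the given separation, and a separation of `insert v S` is built from that (`key`). -/
theorem splitsOn_insert [DecidableEq V] {r : V → V → Prop} (hs : ∀ a b, r a b → r b a)
    (h : PathFree r) {S : Finset V} {v : V} (hv : v ∉ S)
    (hS : SplitsOn (fun a b => ¬ r a b) S) :
    SplitsOn r (insert v S) ∨ SplitsOn (fun a b => ¬ r a b) (insert v S) := by
  have key : ∀ p : V → Prop, (∃ a ∈ S, p a) → (∃ b ∈ S, ¬ p b) →
      (∀ a ∈ S, ∀ b ∈ S, p a → ¬ p b → ¬ r a b) → (∃ y ∈ S, p y ∧ ¬ r v y) →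
      SplitsOn (fun a b => ¬ r a b) (insert v S) := by
    rintro p ⟨a, ha, hpa⟩ ⟨b, hb, hpb⟩ hp ⟨y, hy, hpy, hvy⟩
    by_cases hB : ∃ z ∈ S, ¬ p z ∧ r v z
    · obtain ⟨z, hz, hpz, hvz'⟩ := hB
      -- Since `v` has a neighbour `z` across, its non-neighbours in `p` are cut off from everything
      -- else: an edge from such an `x` to a neighbour `w` of `v` in `p` would make `x w v z` an
      -- induced path.
      refine ⟨fun x => x ∈ S ∧ p x ∧ ¬ r v x, ⟨y, by simp [hy], hy, hpy, hvy⟩,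
        ⟨v, by simp, by simp [hv]⟩, ?_⟩
      rintro x - w hw ⟨hx, hpx, hvx⟩ hnw hxw
      rcases Finset.mem_insert.1 hw with rfl | hw
      · exact hvx (hs _ _ hxw)
      by_cases hpw : p w
      · have hvw : r v w := by grind
        have hxv : x ≠ v := by grind
        have hwv : w ≠ v := by grind
        have hvz : v ≠ z := by grind
        have hne : x ≠ w := by grind
        have hxz : x ≠ z := by grind
        have hwz : w ≠ z := by grind
        rcases h x w v z hne hxv hxz hwv hwz hvz hxw (hs _ _ hvw) hvz' with h' | h' | h'
        · exact hvx (hs _ _ h')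
        · exact hp x hx z hz hpx hpz h'
        · exact hp w hw z hz hpw hpz h'
      · exact hp x hx w hw hpx hpw hxw
    · refine ⟨fun x => x ∈ S ∧ ¬ p x, ⟨b, by simp [hb], hb, hpb⟩, ⟨v, by simp, by simp [hv]⟩, ?_⟩
      grind
  obtain ⟨p, hp1, hp2, hp⟩ := hS
  by_cases hall : ∀ y ∈ S, r v y
  · left
    refine ⟨fun x => x = v, ⟨v, by simp, rfl⟩, ?_, ?_⟩
    · obtain ⟨a, ha, -⟩ := hp1
      exact ⟨a, by simp [ha], by rintro rfl; exact hv ha⟩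
    · grind
  · right
    push Not at hall
    obtain ⟨y, hy, hvy⟩ := hall
    by_cases hpy : p y
    · exact key p hp1 hp2 hp ⟨y, hy, hpy, hvy⟩
    · refine key (fun x => ¬ p x) hp2 ?_ ?_ ⟨y, hy, hpy, hvy⟩
      · simpa using hp1
      · intro a ha b hb hpa hpb hr
        exact hp b hb a ha (not_not.1 hpb) hpa (hs _ _ hr)

/-- A finite graph with at least two vertices and without an induced path on four vertices is
disconnected, or its complement is. -/
theorem PathFree.splitsOn [DecidableEq V] {r : V → V → Prop} (hs : ∀ a b, r a b → r b a)
    (h : PathFree r) (S : Finset V) (hS : S.Nontrivial) :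
    SplitsOn r S ∨ SplitsOn (fun a b => ¬ r a b) S := by
  induction S using Finset.induction_on with
  | empty => simp at hS
  | insert v S hv ih =>
    by_cases hS' : S.Nontrivial
    · rcases ih hS' with h1 | h1
      · have := splitsOn_insert (r := fun a b => ¬ r a b) (fun a b hab hba => hab (hs _ _ hba))
          (h.compl hs) hv (by simpa using h1)
        simpa [or_comm] using this
      · exact splitsOn_insert hs h hv h1
    · have hne : S.Nonempty := by
        rw [Finset.nonempty_iff_ne_empty]
        rintro rfl
        simp at hS
      obtain ⟨w, rfl⟩ : ∃ w, S = {w} := by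
        rcases hne.exists_eq_singleton_or_nontrivial with h | h
        · exact h
        · exact absurd h hS'
      have hvw : v ≠ w := by simpa using hv
      by_cases hr : r v w
      · exact .inl ⟨fun x => x = v, ⟨v, by simp, rfl⟩, ⟨w, by simp, hvw.symm⟩, by grind⟩
      · exact .inr ⟨fun x => x = v, ⟨v, by simp, rfl⟩, ⟨w, by simp, hvw.symm⟩, by grind⟩

end Split

/-! ### Strict orders and their forbidden configurations -/

section Properties

variable {V : Type*} {W : Type*} {G : Digraph V} {H : Digraph W}

/-- The arcs form a strict partial order. -/
structure IsStrict (G : Digraph V) : Prop where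
  loopless : G.Loopless
  trans : ∀ {x y z}, G.Adj x y → G.Adj y z → G.Adj x z

/-- Joined by an arc, in some direction. -/
def Comparable (G : Digraph V) (x y : V) : Prop :=
  G.Adj x y ∨ G.Adj y x

/-- No induced `a → b ← c → d`. -/
def NFree (G : Digraph V) : Prop :=
  ∀ a b c d, G.Adj a b → G.Adj c b → G.Adj c d →
    G.Comparable a c ∨ G.Comparable b d ∨ G.Comparable a d

/-- No two incomparable vertices dominate two incomparable vertices. -/
def CrossFree (G : Digraph V) : Prop :=
  ∀ a b c d, a ≠ b → c ≠ d → G.Adj a c → G.Adj a d → G.Adj b c → G.Adj b d →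
    G.Comparable a b ∨ G.Comparable c d

/-- `a` and `c` are distinct and incomparable, and `b` lies below both or above both. -/
def IsCherry (G : Digraph V) (a b c : V) : Prop :=
  a ≠ c ∧ ¬ G.Comparable a c ∧ (G.Adj a b ∧ G.Adj c b ∨ G.Adj b a ∧ G.Adj b c)

/-- Any two cherries are joined by an arc. -/
def CherriesMeet (G : Digraph V) : Prop :=
  ∀ a b c d e f, G.IsCherry a b c → G.IsCherry d e f →
    ∃ x y, (x = a ∨ x = b ∨ x = c) ∧ (y = d ∨ y = e ∨ y = f) ∧ G.Comparable x y

/-- Any two distinct vertices are comparable. -/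
def IsTotal (G : Digraph V) : Prop :=
  ∀ x y, x ≠ y → G.Comparable x y

theorem Comparable.symm {x y : V} (h : G.Comparable x y) : G.Comparable y x := Or.symm h

/-! ### Elementwise forms of the forbidden subdigraphs -/

theorem IsStrict.asymm (hG : G.IsStrict) {x y : V} (h : G.Adj x y) : ¬ G.Adj y x :=
  fun h' => hG.loopless _ (hG.trans h h')

theorem ofArcs_isInducedIn_iff {n : ℕ} {A : List (Fin n × Fin n)} :
    (ofArcs n A).2.IsInducedIn G ↔
      ∃ f : Fin n → V, (∀ i j, f i = f j → i = j) ∧ ∀ i j, G.Adj (f i) (f j) ↔ (i, j) ∈ A := by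
  constructor
  · rintro ⟨f⟩
    exact ⟨f, fun i j h => f.injective h, fun i j => f.map_rel_iff⟩
  · rintro ⟨f, hf, h⟩
    exact ⟨⟨⟨f, fun i j => hf i j⟩, fun {i j} => h i j⟩⟩

theorem biK₂_isInducedIn_iff (hG : G.Loopless) :
    biK₂.2.IsInducedIn G ↔ ∃ a b, G.Adj a b ∧ G.Adj b a := by
  rw [biK₂, ofArcs_isInducedIn_iff]
  constructor
  · rintro ⟨f, -, h⟩
    exact ⟨f 0, f 1, by simp [h], by simp [h]⟩
  · rintro ⟨a, b, hab, hba⟩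
    have := hG a
    have := hG b
    refine ⟨![a, b], ?_, ?_⟩ <;> simp [Fin.forall_fin_succ] <;> grind

theorem D₁_isInducedIn_iff (hG : G.Loopless) (h2 : ∀ a b, G.Adj a b → ¬ G.Adj b a) :
    D₁.2.IsInducedIn G ↔ ∃ a b c, G.Adj a b ∧ G.Adj b c ∧ ¬ G.Comparable a c := by
  rw [D₁, ofArcs_isInducedIn_iff]
  constructor
  · rintro ⟨f, -, h⟩
    exact ⟨f 0, f 1, f 2, by simp [h], by simp [h], by simp [h, Comparable]⟩
  · rintro ⟨a, b, c, hab, hbc, hac⟩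
    unfold Loopless at hG
    unfold Comparable at hac
    refine ⟨![a, b, c], ?_, ?_⟩ <;> simp [Fin.forall_fin_succ] <;> grind

theorem D₅_isInducedIn_iff (hG : G.Loopless) (h2 : ∀ a b, G.Adj a b → ¬ G.Adj b a) :
    D₅.2.IsInducedIn G ↔ ∃ a b c, G.Adj a b ∧ G.Adj b c ∧ G.Adj c a := by
  rw [D₅, ofArcs_isInducedIn_iff]
  constructor
  · rintro ⟨f, -, h⟩
    exact ⟨f 0, f 1, f 2, by simp [h], by simp [h], by simp [h]⟩
  · rintro ⟨a, b, c, hab, hbc, hca⟩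
    unfold Loopless at hG
    refine ⟨![a, b, c], ?_, ?_⟩ <;> simp [Fin.forall_fin_succ] <;> grind

theorem IsStrict.D₈_isInducedIn_iff (hG : G.IsStrict) : D₈.2.IsInducedIn G ↔ ¬ G.NFree := by
  rw [D₈, ofArcs_isInducedIn_iff]
  constructor
  · rintro ⟨f, -, h⟩ hN
    have := hN (f 0) (f 1) (f 2) (f 3)
    simp [h, Comparable] at this
  · intro hN
    simp only [NFree, not_forall, not_or] at hN
    obtain ⟨a, b, c, d, hab, hcb, hcd, hac, hbd, had⟩ := hN
    have h0 := hG.loopless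
    have h1 := @hG.asymm
    unfold Loopless at h0
    simp only [Comparable, not_or] at hac hbd had
    have hne : a ≠ b ∧ a ≠ c ∧ a ≠ d ∧ b ≠ c ∧ b ≠ d ∧ c ≠ d := by
      refine ⟨?_, ?_, ?_, ?_, ?_, ?_⟩ <;> rintro rfl <;> simp_all
    refine ⟨![a, b, c, d], ?_, ?_⟩ <;> simp [Fin.forall_fin_succ] <;> grind

theorem IsStrict.D₁₂_isInducedIn_iff (hG : G.IsStrict) :
    D₁₂.2.IsInducedIn G ↔ ¬ G.CrossFree := by
  rw [D₁₂, ofArcs_isInducedIn_iff]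
  constructor
  · rintro ⟨f, hf, h⟩ hN
    have := hN (f 0) (f 1) (f 2) (f 3) (fun e => by simpa using hf _ _ e)
      (fun e => by simpa using hf _ _ e)
    simp [h, Comparable] at this
  · intro hN
    simp only [CrossFree, not_forall, not_or] at hN
    obtain ⟨a, b, c, d, hab, hcd, hac, had, hbc, hbd, h1, h2⟩ := hN
    have h0 := hG.loopless
    have h3 := @hG.asymm
    unfold Loopless at h0
    unfold Comparable at h1 h2
    refine ⟨![a, b, c, d], ?_, ?_⟩ <;> simp [Fin.forall_fin_succ] <;> grind

theorem not_cherriesMeet_iff : ¬ G.CherriesMeet ↔ ∃ a b c d e f, G.IsCherry a b c ∧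
    G.IsCherry d e f ∧
      (¬ G.Comparable a d ∧ ¬ G.Comparable a e ∧ ¬ G.Comparable a f) ∧
      (¬ G.Comparable b d ∧ ¬ G.Comparable b e ∧ ¬ G.Comparable b f) ∧
      (¬ G.Comparable c d ∧ ¬ G.Comparable c e ∧ ¬ G.Comparable c f) := by
  simp only [CherriesMeet, not_forall, exists_prop]
  constructor
  · rintro ⟨a, b, c, d, e, f, h1, h2, h⟩
    refine ⟨a, b, c, d, e, f, h1, h2, ⟨?_, ?_, ?_⟩, ⟨?_, ?_, ?_⟩, ⟨?_, ?_, ?_⟩⟩ <;>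
      exact fun h' => h ⟨_, _, by simp, by simp, h'⟩
  · rintro ⟨a, b, c, d, e, f, h1, h2, h⟩
    exact ⟨a, b, c, d, e, f, h1, h2, by grind⟩

theorem IsStrict.cherries_isInducedIn_iff (hG : G.IsStrict) :
    D₂₁.2.IsInducedIn G ∨ D₂₂.2.IsInducedIn G ∨ D₂₃.2.IsInducedIn G ↔ ¬ G.CherriesMeet := by
  constructor
  · simp only [D₂₁, D₂₂, D₂₃, ofArcs_isInducedIn_iff]
    rintro (⟨f, hf, h⟩ | ⟨f, hf, h⟩ | ⟨f, hf, h⟩)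
    all_goals
      have h02 : f 0 ≠ f 2 := fun e => by simpa using hf _ _ e
      have h35 : f 3 ≠ f 5 := fun e => by simpa using hf _ _ e
      refine not_cherriesMeet_iff.2 ⟨f 0, f 1, f 2, f 3, f 4, f 5, ?_⟩
      simp [IsCherry, Comparable, h, h02, h35]
  · intro h
    obtain ⟨a, b, c, d, e, f, ⟨hac, h1, h2⟩, ⟨hdf, h3, h4⟩, ha, hb, hc⟩ :=
      not_cherriesMeet_iff.1 h
    have h0 := hG.loopless
    have h5 := @hG.asymm
    unfold Loopless at h0
    simp only [Comparable, not_or] at h1 h3 ha hb hc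
    simp only [D₂₁, D₂₂, D₂₃, ofArcs_isInducedIn_iff]
    -- The six vertices are distinct: each vertex of a cherry is joined to another of its vertices,
    -- so a shared vertex would join the two cherries. Both mixed cases give `D₂₃`, one of them
    -- after swapping the cherries.
    rcases h2 with ⟨h2, h2'⟩ | ⟨h2, h2'⟩ <;> rcases h4 with ⟨h4, h4'⟩ | ⟨h4, h4'⟩
    · refine .inl ⟨![a, b, c, d, e, f], ?_, ?_⟩ <;> simp [Fin.forall_fin_succ] <;>
        split_ands <;> grind
    · refine .inr (.inr ⟨![d, e, f, a, b, c], ?_, ?_⟩) <;> simp [Fin.forall_fin_succ] <;>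
        split_ands <;> grind
    · refine .inr (.inr ⟨![a, b, c, d, e, f], ?_, ?_⟩) <;> simp [Fin.forall_fin_succ] <;>
        split_ands <;> grind
    · refine .inr (.inl ⟨![a, b, c, d, e, f], ?_, ?_⟩) <;> simp [Fin.forall_fin_succ] <;>
        split_ands <;> grind

theorem isFree_insert {H : OnFin} {F : Set OnFin} :
    G.IsFree (insert H F) ↔ ¬ H.2.IsInducedIn G ∧ G.IsFree F := by
  simp [IsFree]

theorem isFree_singleton {H : OnFin} : G.IsFree {H} ↔ ¬ H.2.IsInducedIn G := by
  simp [IsFree]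

/-- Freeness of `D₁₂`, `D₂₁`, `D₂₂` and `D₂₃`, elementwise. -/
theorem IsStrict.isFree_iff (hG : G.IsStrict) :
    G.IsFree {D₁₂, D₂₁, D₂₂, D₂₃} ↔ G.CrossFree ∧ G.CherriesMeet := by
  have h1 := hG.D₁₂_isInducedIn_iff
  have h2 := hG.cherries_isInducedIn_iff
  simp only [isFree_insert, isFree_singleton]
  tauto

theorem isStrict_of_isTransitive (hG : G.Loopless) (h : G.IsTransitive)
    (h2 : ¬ biK₂.2.IsInducedIn G) : G.IsStrict := by
  rw [biK₂_isInducedIn_iff hG] at h2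
  refine ⟨hG, fun {x y z} hxy hyz => h x y z hxy hyz ?_⟩
  rintro rfl
  exact h2 ⟨_, _, hxy, hyz⟩

theorem isFree_and_isTransitive_iff (hG : G.Loopless) :
    G.IsFree {D₈, biK₂, D₁₂, D₂₁, D₂₂, D₂₃} ∧ G.IsTransitive ↔
      G.IsStrict ∧ G.NFree ∧ G.CrossFree ∧ G.CherriesMeet := by
  rw [isFree_insert, isFree_insert]
  constructor
  · rintro ⟨⟨h8, h2, h⟩, ht⟩
    have hs := isStrict_of_isTransitive hG ht h2
    exact ⟨hs, not_not.1 (fun hN => h8 (hs.D₈_isInducedIn_iff.2 hN)), hs.isFree_iff.1 h⟩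
  · rintro ⟨hs, hN, h⟩
    refine ⟨⟨fun h8 => hs.D₈_isInducedIn_iff.1 h8 hN, ?_, hs.isFree_iff.2 h⟩,
      fun x y z hxy hyz _ => hs.trans hxy hyz⟩
    rw [biK₂_isInducedIn_iff hG]
    rintro ⟨a, b, hab, hba⟩
    exact hs.asymm hab hba

/-- If `x → y → z` lacks the arc `x → z`, then either `x` and `z` are not joined, which is `D₁`, or
`z → x`, which is `D₅`. -/
theorem isFree_iff_isFree_and_isTransitive (hG : G.Loopless) :
    G.IsFree {D₁, D₅, D₈, biK₂, D₁₂, D₂₁, D₂₂, D₂₃} ↔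
      G.IsFree {D₈, biK₂, D₁₂, D₂₁, D₂₂, D₂₃} ∧ G.IsTransitive := by
  rw [isFree_insert, isFree_insert]
  have h2 : G.IsFree {D₈, biK₂, D₁₂, D₂₁, D₂₂, D₂₃} → ∀ a b, G.Adj a b → ¬ G.Adj b a := by
    intro h a b hab hba
    exact h biK₂ (by simp) ((biK₂_isInducedIn_iff hG).2 ⟨a, b, hab, hba⟩)
  constructor
  · rintro ⟨h1, h5, h⟩
    rw [D₁_isInducedIn_iff hG (h2 h)] at h1
    rw [D₅_isInducedIn_iff hG (h2 h)] at h5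
    refine ⟨h, fun x y z hxy hyz _ => ?_⟩
    by_contra hxz
    refine h1 ⟨x, y, z, hxy, hyz, ?_⟩
    rintro (h' | h')
    · exact hxz h'
    · exact h5 ⟨x, y, z, hxy, hyz, h'⟩
  · rintro ⟨h, ht⟩
    have hs := ((isFree_and_isTransitive_iff hG).1 ⟨h, ht⟩).1
    refine ⟨?_, ?_, h⟩
    · rw [D₁_isInducedIn_iff hG (h2 h)]
      rintro ⟨a, b, c, hab, hbc, hac⟩
      exact hac (.inl (hs.trans hab hbc))
    · rw [D₅_isInducedIn_iff hG (h2 h)]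
      rintro ⟨a, b, c, hab, hbc, hca⟩
      exact hs.asymm (hs.trans hab hbc) hca

/-! ### Closure properties -/

theorem IsStrict.of_isInducedIn (hH : H.IsStrict) (h : G.IsInducedIn H) : G.IsStrict := by
  obtain ⟨f⟩ := h
  exact ⟨fun x hx => hH.loopless _ (f.map_rel_iff.2 hx),
    fun hxy hyz => f.map_rel_iff.1 (hH.trans (f.map_rel_iff.2 hxy) (f.map_rel_iff.2 hyz))⟩

theorem NFree.of_isInducedIn (hH : H.NFree) (h : G.IsInducedIn H) : G.NFree := by
  obtain ⟨f⟩ := h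
  intro a b c d hab hcb hcd
  simpa [Comparable, f.map_rel_iff] using hH (f a) (f b) (f c) (f d) (f.map_rel_iff.2 hab)
    (f.map_rel_iff.2 hcb) (f.map_rel_iff.2 hcd)

theorem CrossFree.of_isInducedIn (hH : H.CrossFree) (h : G.IsInducedIn H) : G.CrossFree := by
  obtain ⟨f⟩ := h
  intro a b c d hab hcd
  simpa [Comparable, f.map_rel_iff] using hH (f a) (f b) (f c) (f d) (f.injective.ne hab)
    (f.injective.ne hcd)

theorem CherriesMeet.of_isInducedIn (hH : H.CherriesMeet) (h : G.IsInducedIn H) :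
    G.CherriesMeet := by
  obtain ⟨φ⟩ := h
  contrapose! hH
  rw [not_cherriesMeet_iff] at hH ⊢
  obtain ⟨a, b, c, d, e, f, h⟩ := hH
  refine ⟨φ a, φ b, φ c, φ d, φ e, φ f, ?_⟩
  simpa [IsCherry, Comparable, φ.map_rel_iff] using h

theorem IsIso.isInducedIn_symm (h : G.IsIso H) : H.IsInducedIn G :=
  let ⟨f⟩ := h
  ⟨f.symm.toRelEmbedding⟩

@[simp] theorem disjUnion_adj_inl_inl {x y : V} :
    (G.disjUnion H).Adj (.inl x) (.inl y) ↔ G.Adj x y := by simp [disjUnion]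
@[simp] theorem disjUnion_adj_inr_inr {x y : W} :
    (G.disjUnion H).Adj (.inr x) (.inr y) ↔ H.Adj x y := by simp [disjUnion]
@[simp] theorem disjUnion_adj_inl_inr {x : V} {y : W} :
    ¬ (G.disjUnion H).Adj (.inl x) (.inr y) := by simp [disjUnion]
@[simp] theorem disjUnion_adj_inr_inl {x : W} {y : V} :
    ¬ (G.disjUnion H).Adj (.inr x) (.inl y) := by simp [disjUnion]
@[simp] theorem orderComp_adj_inl_inl {x y : V} :
    (G.orderComp H).Adj (.inl x) (.inl y) ↔ G.Adj x y := by simp [orderComp]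
@[simp] theorem orderComp_adj_inr_inr {x y : W} :
    (G.orderComp H).Adj (.inr x) (.inr y) ↔ H.Adj x y := by simp [orderComp]
@[simp] theorem orderComp_adj_inl_inr {x : V} {y : W} :
    (G.orderComp H).Adj (.inl x) (.inr y) := by simp [orderComp]
@[simp] theorem orderComp_adj_inr_inl {x : W} {y : V} :
    ¬ (G.orderComp H).Adj (.inr x) (.inl y) := by simp [orderComp]

theorem IsStrict.disjUnion (hG : G.IsStrict) (hH : H.IsStrict) : (G.disjUnion H).IsStrict := by
  constructor
  · rintro (x | x)
    · simpa using hG.loopless x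
    · simpa using hH.loopless x
  · rintro (x | x) (y | y) (z | z)
    all_goals simp
    · exact hG.trans
    · exact hH.trans

theorem IsStrict.orderComp (hG : G.IsStrict) (hH : H.IsStrict) : (G.orderComp H).IsStrict := by
  constructor
  · rintro (x | x)
    · simpa using hG.loopless x
    · simpa using hH.loopless x
  · rintro (x | x) (y | y) (z | z)
    all_goals simp
    · exact hG.trans
    · exact hH.trans

theorem NFree.disjUnion (hG : G.NFree) (hH : H.NFree) : (G.disjUnion H).NFree := by
  rintro (a | a) (b | b) (c | c) (d | d)
  all_goals simp [Comparable]
  · exact hG a b c d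
  · exact hH a b c d

theorem NFree.orderComp (hG : G.NFree) (hH : H.NFree) : (G.orderComp H).NFree := by
  rintro (a | a) (b | b) (c | c) (d | d)
  all_goals simp [Comparable]
  · exact hG a b c d
  · exact hH a b c d

theorem CrossFree.disjUnion (hG : G.CrossFree) (hH : H.CrossFree) :
    (G.disjUnion H).CrossFree := by
  rintro (a | a) (b | b) (c | c) (d | d)
  all_goals simp [Comparable]
  · exact hG a b c d
  · exact hH a b c d

/-- The only new configuration has its lower pair in `G` and its upper pair in `H`, and a total
factor has no incomparable pair. -/
theorem CrossFree.orderComp (hG : G.CrossFree) (hH : H.CrossFree) (h : G.IsTotal ∨ H.IsTotal) :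
    (G.orderComp H).CrossFree := by
  rintro (a | a) (b | b) (c | c) (d | d)
  all_goals simp [Comparable]
  · exact hG a b c d
  · intro hab hcd
    rcases h with h | h
    · exact .inl (h _ _ hab)
    · exact .inr (h _ _ hcd)
  · exact hH a b c d

theorem IsTotal.not_isCherry (h : G.IsTotal) {a b c : V} : ¬ G.IsCherry a b c :=
  fun h' => h'.2.1 (h _ _ h'.1)

/-- A cherry is connected through its centre, so it lies on one side, and the total side contains
none. -/
theorem CherriesMeet.disjUnion (hG : G.CherriesMeet) (hH : H.IsTotal) :
    (G.disjUnion H).CherriesMeet := by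
  have key : ∀ a b c, (G.disjUnion H).IsCherry a b c →
      ∃ a' b' c', a = .inl a' ∧ b = .inl b' ∧ c = .inl c' ∧ G.IsCherry a' b' c' := by
    rintro (a | a) (b | b) (c | c)
    all_goals simp [IsCherry, Comparable]
    intro hac h1 h2
    exact absurd (hH a c hac) (by simp [Comparable, h1, h2])
  intro a b c d e f h1 h2
  obtain ⟨a, b, c, rfl, rfl, rfl, h1'⟩ := key a b c h1
  obtain ⟨d, e, f, rfl, rfl, rfl, h2'⟩ := key d e f h2
  obtain ⟨x, y, hx, hy, hxy⟩ := hG a b c d e f h1' h2'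
  exact ⟨.inl x, .inl y, by simpa using hx, by simpa using hy, by simpa [Comparable] using hxy⟩

/-- Every vertex of `G` is joined to every vertex of `H`, so two cherries with no arc between them
lie in the same factor. -/
theorem CherriesMeet.orderComp (hG : G.CherriesMeet) (hH : H.CherriesMeet) :
    (G.orderComp H).CherriesMeet := by
  have hcomp : ∀ x y, (G.orderComp H).Comparable (.inl x) (.inr y) := fun x y => by
    simp [Comparable]
  by_contra hn
  obtain ⟨a, b, c, d, e, f, h1, h2, h3, h4, h5⟩ := not_cherriesMeet_iff.1 hn
  rcases a with a | a <;> rcases b with b | b <;> rcases c with c | c <;>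
    rcases d with d | d <;> rcases e with e | e <;> rcases f with f | f <;>
    simp [Comparable] at h3 h4 h5
  · refine not_cherriesMeet_iff.2 ⟨a, b, c, d, e, f, ?_⟩ hG
    simpa [IsCherry, Comparable, h3, h4, h5] using And.intro h1 h2
  · refine not_cherriesMeet_iff.2 ⟨a, b, c, d, e, f, ?_⟩ hH
    simpa [IsCherry, Comparable, h3, h4, h5] using And.intro h1 h2

theorem IsTransitiveTournament.isTotal (h : G.IsTransitiveTournament) : G.IsTotal := by
  intro x y hxy
  have := h.2.2.1.2 x y hxy
  unfold Comparable
  tauto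

theorem IsTransitiveTournament.isStrict (h : G.IsTransitiveTournament) : G.IsStrict := by
  obtain ⟨-, -, ht, htr⟩ := h
  refine ⟨ht.1, fun {x y z} hxy hyz => htr x y z hxy hyz ?_⟩
  rintro rfl
  have hne : x ≠ y := by
    rintro rfl
    exact ht.1 _ hxy
  exact (ht.2 x y hne).1 hxy hyz

theorem IsTotal.nFree (h : G.IsTotal) : G.NFree := by
  intro a b c d hab hcb hcd
  by_cases hac : a = c
  · subst hac
    exact .inr (.inr (.inl hcd))
  · exact .inl (h _ _ hac)

theorem IsTotal.crossFree (h : G.IsTotal) : G.CrossFree :=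
  fun _ _ _ _ hab _ _ _ _ _ => .inl (h _ _ hab)

theorem IsTotal.cherriesMeet (h : G.IsTotal) : G.CherriesMeet :=
  fun _ _ _ _ _ _ h1 _ => absurd h1 h.not_isCherry

theorem IsStrict.isTransitiveTournament [Finite V] [Nonempty V] (hs : G.IsStrict)
    (h : G.IsTotal) : G.IsTransitiveTournament := by
  refine ⟨‹_›, ‹_›, ⟨hs.loopless, fun x y hxy => ⟨hs.asymm, fun hyx => ?_⟩⟩,
    fun x y z hxy hyz _ => hs.trans hxy hyz⟩
  exact (h x y hxy).resolve_right hyx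

/-! ### Decomposition -/

/-- The subdigraph induced on the vertices satisfying `p`. -/
def restrict (G : Digraph V) (p : V → Prop) : Digraph {x // p x} where
  Adj x y := G.Adj x y

theorem restrict_isInducedIn (p : V → Prop) : (G.restrict p).IsInducedIn G :=
  ⟨⟨⟨Subtype.val, Subtype.val_injective⟩, Iff.rfl⟩⟩

theorem disjUnion_restrict_isIso {p : V → Prop}
    (h : ∀ x y, p x → ¬ p y → ¬ G.Comparable x y) :
    ((G.restrict p).disjUnion (G.restrict fun x => ¬ p x)).IsIso G := by
  classical
  refine ⟨⟨Equiv.sumCompl p, ?_⟩⟩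
  rintro (x | x) (y | y)
  · simp [restrict]
  · simpa using fun h' => h x y x.2 y.2 (.inl h')
  · simpa using fun h' => h y x y.2 x.2 (.inr h')
  · simp [restrict]

theorem orderComp_restrict_isIso (hs : G.IsStrict) {p : V → Prop}
    (h : ∀ x y, p x → ¬ p y → G.Adj x y) :
    ((G.restrict p).orderComp (G.restrict fun x => ¬ p x)).IsIso G := by
  classical
  refine ⟨⟨Equiv.sumCompl p, ?_⟩⟩
  rintro (x | x) (y | y)
  · simp [restrict]
  · simpa using h x y x.2 y.2
  · simpa using hs.asymm (h y x y.2 x.2)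
  · simp [restrict]

/-- By transitivity, arcs along an induced path alternate in direction, so the path is an N read
from one end or the other. -/
theorem IsStrict.pathFree_comparable (hs : G.IsStrict) (hN : G.NFree) :
    PathFree G.Comparable := by
  intro a b c d hab hac had hbc hbd hcd h1 h2 h3
  by_contra! h
  obtain ⟨h4, h5, h6⟩ := h
  have ht := @hs.trans
  have hN1 := hN a b c d
  have hN2 := hN d c b a
  unfold Comparable at *
  grind

theorem IsStrict.exists_isMin [Finite V] (hs : G.IsStrict) {p : V → Prop} (hp : ∃ x, p x) :
    ∃ x, p x ∧ ∀ y, p y → ¬ G.Adj y x := by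
  have : IsTrans V G.Adj := ⟨fun _ _ _ => hs.trans⟩
  have : Std.Irrefl G.Adj := ⟨hs.loopless⟩
  obtain ⟨x, hx, h⟩ := (Finite.wellFounded_of_trans_of_irrefl G.Adj).has_min {x | p x} hp
  exact ⟨x, hx, h⟩

/-- A split with all pairs comparable need not be directed. Take minimal elements `a`, `b` of the
two parts; if `a → b`, the vertices below `b` all lie in `p` by minimality of `b`, and they lie
below every other vertex. The case `b → a` is symmetric. -/
theorem IsStrict.exists_series [Finite V] (hs : G.IsStrict) {p : V → Prop} (h1 : ∃ x, p x)
    (h2 : ∃ x, ¬ p x) (h : ∀ x y, p x → ¬ p y → G.Comparable x y) :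
    ∃ q : V → Prop, (∃ x, q x) ∧ (∃ x, ¬ q x) ∧ ∀ x y, q x → ¬ q y → G.Adj x y := by
  obtain ⟨a, ha, hamin⟩ := hs.exists_isMin h1
  obtain ⟨b, hb, hbmin⟩ := hs.exists_isMin h2
  have ht := @hs.trans
  rcases h a b ha hb with hab | hba
  · refine ⟨fun x => G.Adj x b, ⟨a, hab⟩, ⟨b, hs.loopless b⟩, fun x y hx hy => ?_⟩
    unfold Comparable at h
    grind
  · refine ⟨fun x => G.Adj x a, ⟨b, hba⟩, ⟨a, hs.loopless a⟩, fun x y hx hy => ?_⟩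
    unfold Comparable at h
    grind

/-- A finite strict order without an induced `N` and with at least two elements is a disjoint
union or an order composition of two nonempty parts. -/
theorem IsStrict.exists_split [Finite V] [Nontrivial V] (hs : G.IsStrict) (hN : G.NFree) :
    ∃ q : V → Prop, (∃ x, q x) ∧ (∃ x, ¬ q x) ∧
      ((∀ x y, q x → ¬ q y → G.Adj x y) ∨ ∀ x y, q x → ¬ q y → ¬ G.Comparable x y) := by
  classical
  have := Fintype.ofFinite V
  rcases (hs.pathFree_comparable hN).splitsOn (fun _ _ h => h.symm) Finset.univ
    Finset.univ_nontrivial with ⟨p, h1, h2, h⟩ | ⟨p, h1, h2, h⟩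
  · obtain ⟨q, hq1, hq2, hq⟩ := hs.exists_series (p := p) (by simpa using h1) (by simpa using h2)
      (by simpa using h)
    exact ⟨q, hq1, hq2, .inl hq⟩
  · exact ⟨p, by simpa using h1, by simpa using h2, .inr (by simpa using h)⟩

/-- A part that is disjoint from the rest and has no cherry contains a total such part. -/
theorem IsStrict.exists_total_part (hs : G.IsStrict) {p : V → Prop} (hp : ∃ x, p x)
    (hsep : ∀ x y, p x → ¬ p y → ¬ G.Comparable x y)
    (hc : ∀ a b c, p a → p b → p c → ¬ G.IsCherry a b c) :
    ∃ q : V → Prop, (∃ x, q x) ∧ (∀ x, q x → p x) ∧ (G.restrict q).IsTotal ∧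
      ∀ x y, q x → ¬ q y → ¬ G.Comparable x y := by
  obtain ⟨x, hx⟩ := hp
  have ht := @hs.trans
  have hmem : ∀ y, G.Comparable x y → p y := fun y hy => by
    by_contra h
    exact hsep x y hx h hy
  -- Without cherries comparability is transitive: if `u` and `w` are incomparable and `v` is
  -- comparable to both, then `v` is above both or below both. The part sought is thus the
  -- comparability class of `x`.
  have hfwd : ∀ u v w, p u → p v → p w → G.Comparable u v → G.Comparable v w → u ≠ w →
      G.Comparable u w := by
    intro u v w hu hv hw huv hvw huw
    by_contra h
    refine hc u v w hu hv hw ⟨huw, h, ?_⟩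
    unfold Comparable at *
    grind
  refine ⟨fun y => y = x ∨ G.Comparable x y, ⟨x, .inl rfl⟩, ?_, ?_, ?_⟩
  · rintro y (rfl | hy)
    · exact hx
    · exact hmem y hy
  · rintro ⟨y, hy⟩ ⟨z, hz⟩ hyz
    have hyz' : y ≠ z := fun h => hyz (Subtype.ext h)
    change G.Comparable y z
    rcases hy with rfl | hy <;> rcases hz with rfl | hz
    · exact absurd rfl hyz'
    · exact hz
    · exact hy.symm
    · exact hfwd y x z (hmem y hy) hx (hmem z hz) hy.symm hz hyz'
  · rintro y z (rfl | hy) hz hyz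
    · exact hz (.inr hyz)
    · have hpz : p z := by
        by_contra h
        exact hsep y z (hmem y hy) h hyz
      push Not at hz
      exact hz.2 (hfwd x y z hx (hmem y hy) hpz hy hyz (Ne.symm hz.1))

end Properties

/-! ### The two recursively defined classes -/

section Classes

variable {V : Type u} {G : Digraph V}

theorem IsOrientedCograph.isStrict (h : G.IsOrientedCograph) : G.IsStrict ∧ G.NFree := by
  induction h with
  | single => exact ⟨⟨fun _ h => h, fun h => h.elim⟩, fun _ _ _ _ h => h.elim⟩
  | disjUnion _ _ h1 h2 => exact ⟨h1.1.disjUnion h2.1, h1.2.disjUnion h2.2⟩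
  | orderComp _ _ h1 h2 => exact ⟨h1.1.orderComp h2.1, h1.2.orderComp h2.2⟩
  | ofIso _ e h =>
    exact ⟨h.1.of_isInducedIn e.isInducedIn_symm, h.2.of_isInducedIn e.isInducedIn_symm⟩

theorem IsOrientedCoWeaklyQuasiThreshold.isStrict (h : G.IsOrientedCoWeaklyQuasiThreshold) :
    G.IsStrict ∧ G.NFree ∧ G.CrossFree ∧ G.CherriesMeet := by
  induction h with
  | tournament hT =>
    have ht := hT.isTotal
    exact ⟨hT.isStrict, ht.nFree, ht.crossFree, ht.cherriesMeet⟩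
  | orderComp_right _ hT ih =>
    obtain ⟨h1, h2, h3, h4⟩ := ih
    have ht := hT.isTotal
    exact ⟨h1.orderComp hT.isStrict, h2.orderComp ht.nFree,
      h3.orderComp ht.crossFree (.inr ht), h4.orderComp ht.cherriesMeet⟩
  | orderComp_left _ hT ih =>
    obtain ⟨h1, h2, h3, h4⟩ := ih
    have ht := hT.isTotal
    exact ⟨hT.isStrict.orderComp h1, ht.nFree.orderComp h2,
      ht.crossFree.orderComp h3 (.inl ht), ht.cherriesMeet.orderComp h4⟩
  | disjUnion _ hT ih =>
    obtain ⟨h1, h2, h3, h4⟩ := ih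
    have ht := hT.isTotal
    exact ⟨h1.disjUnion hT.isStrict, h2.disjUnion ht.nFree,
      h3.disjUnion ht.crossFree, h4.disjUnion ht⟩
  | ofIso _ e ih =>
    obtain ⟨h1, h2, h3, h4⟩ := ih
    have hi := e.isInducedIn_symm
    exact ⟨h1.of_isInducedIn hi, h2.of_isInducedIn hi, h3.of_isInducedIn hi,
      h4.of_isInducedIn hi⟩

theorem IsStrict.isOrientedCograph [Finite V] [Nonempty V] (hs : G.IsStrict) (hN : G.NFree) :
    G.IsOrientedCograph := by
  induction hn : Nat.card V using Nat.strong_induction_on generalizing V with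
  | _ n ih =>
    subst hn
    rcases subsingleton_or_nontrivial V with hV | hV
    · let := Classical.inhabited_of_nonempty ‹Nonempty V›
      let := Unique.mk' V
      have : G = ⊥ := by
        ext x y
        obtain rfl := Subsingleton.elim x y
        exact iff_of_false (hs.loopless x) id
      rw [this]
      exact .single
    · have hrec : ∀ p : V → Prop, (∃ x, p x) → (∃ x, ¬ p x) →
          (G.restrict p).IsOrientedCograph := by
        rintro p ⟨x, hx⟩ ⟨y, hy⟩
        have : Nonempty {x // p x} := ⟨⟨x, hx⟩⟩
        exact ih _ (Finite.card_subtype_lt hy) (hs.of_isInducedIn (restrict_isInducedIn p))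
          (hN.of_isInducedIn (restrict_isInducedIn p)) rfl
      obtain ⟨q, h1, h2, h⟩ := hs.exists_split hN
      have hq := hrec q h1 h2
      have hq' := hrec (fun x => ¬ q x) h2 (by simpa using h1)
      rcases h with h | h
      · exact (hq.orderComp hq').ofIso (orderComp_restrict_isIso hs h)
      · exact (hq.disjUnion hq').ofIso (disjUnion_restrict_isIso h)

theorem IsStrict.isOrientedCoWeaklyQuasiThreshold [Finite V] [Nonempty V] (hs : G.IsStrict)
    (hN : G.NFree) (hX : G.CrossFree) (hC : G.CherriesMeet) :
    G.IsOrientedCoWeaklyQuasiThreshold := by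
  induction hn : Nat.card V using Nat.strong_induction_on generalizing V with
  | _ n ih =>
    subst hn
    rcases subsingleton_or_nontrivial V with hV | hV
    · exact .tournament (hs.isTransitiveTournament fun x y h => absurd (Subsingleton.elim x y) h)
    have hrec : ∀ p : V → Prop, (∃ x, p x) → (∃ x, ¬ p x) →
        (G.restrict p).IsOrientedCoWeaklyQuasiThreshold := by
      rintro p ⟨x, hx⟩ ⟨y, hy⟩
      have : Nonempty {x // p x} := ⟨⟨x, hx⟩⟩
      have hi := G.restrict_isInducedIn p
      exact ih _ (Finite.card_subtype_lt hy) (hs.of_isInducedIn hi)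
        (hN.of_isInducedIn hi) (hX.of_isInducedIn hi) (hC.of_isInducedIn hi) rfl
    have htour : ∀ p : V → Prop, (∃ x, p x) → (G.restrict p).IsTotal →
        (G.restrict p).IsTransitiveTournament := by
      rintro p ⟨x, hx⟩ ht
      have : Nonempty {x // p x} := ⟨⟨x, hx⟩⟩
      exact (hs.of_isInducedIn (restrict_isInducedIn p)).isTransitiveTournament ht
    obtain ⟨q, h1, h2, h | h⟩ := hs.exists_split hN
    -- An incomparable pair in each factor would violate `CrossFree`.
    · have hcase : (G.restrict q).IsTotal ∨ (G.restrict fun x => ¬ q x).IsTotal := by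
        by_contra hcon
        simp only [IsTotal, not_or, not_forall] at hcon
        obtain ⟨⟨⟨a, ha⟩, ⟨b, hb⟩, hab, hab'⟩, ⟨⟨c, hc⟩, ⟨d, hd⟩, hcd, hcd'⟩⟩ := hcon
        rcases hX a b c d (by simpa using hab) (by simpa using hcd) (h a c ha hc) (h a d ha hd)
          (h b c hb hc) (h b d hb hd) with h' | h'
        · exact hab' h'
        · exact hcd' h'
      refine .ofIso ?_ (orderComp_restrict_isIso hs h)
      rcases hcase with ht | ht
      · exact .orderComp_left (hrec _ h2 (by simpa using h1)) (htour _ h1 ht)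
      · exact .orderComp_right (hrec _ h1 h2) (htour _ h2 ht)
    -- A cherry-free side contains a total part `r` isolated from the rest. The tournament must be
    -- the right summand, so the split is along `¬ r` and the tournament lives on `¬ ¬ r`.
    · have hsplit : ∀ p : V → Prop, (∃ x, p x) → (∃ x, ¬ p x) →
          (∀ x y, p x → ¬ p y → ¬ G.Comparable x y) →
          (∀ a b c, p a → p b → p c → ¬ G.IsCherry a b c) →
          G.IsOrientedCoWeaklyQuasiThreshold := by
        intro p h1 h2 hp hc
        obtain ⟨r, hr1, hr2, hr3, hr4⟩ := hs.exists_total_part h1 hp hc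
        obtain ⟨y, hy⟩ := h2
        have hr5 : ∃ x, ¬ r x := ⟨y, fun h => hy (hr2 y h)⟩
        have hr6 : ∃ x, ¬ ¬ r x := by simpa using hr1
        refine .ofIso (.disjUnion (hrec (fun x => ¬ r x) hr5 hr6)
          (htour (fun x => ¬ ¬ r x) hr6 ?_)) (disjUnion_restrict_isIso ?_)
        · rintro ⟨x, hx⟩ ⟨y, hy⟩ hxy
          exact hr3 ⟨x, not_not.1 hx⟩ ⟨y, not_not.1 hy⟩ (by simpa using hxy)
        · intro x y hx hy hxy
          exact hr4 y x (not_not.1 hy) hx hxy.symm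
      -- Cherries on both sides would be joined by an arc across the separation, so at least one
      -- side is cherry-free.
      by_cases hq : ∀ a b c, q a → q b → q c → ¬ G.IsCherry a b c
      · exact hsplit q h1 h2 h hq
      · refine hsplit (fun x => ¬ q x) h2 (by simpa using h1)
          (fun x y hx hy hxy => h y x (not_not.1 hy) hx hxy.symm) ?_
        push Not at hq
        obtain ⟨a, b, c, ha, hb, hc, habc⟩ := hq
        intro d e f hd he hf hdef
        obtain ⟨x, y, hx, hy, hxy⟩ := hC a b c d e f habc hdef
        refine h x y ?_ ?_ hxy
        · rcases hx with rfl | rfl | rfl <;> assumption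
        · rcases hy with rfl | rfl | rfl <;> assumption

end Classes

end Digraph

theorem mainTheorem9 {V : Type u} [Finite V] [Nonempty V] (G : Digraph V) (hG : G.Loopless) :
    List.TFAE [
      G.IsOrientedCoWeaklyQuasiThreshold,
      G.IsFree {Digraph.D₁, Digraph.D₅, Digraph.D₈, Digraph.biK₂,
        Digraph.D₁₂, Digraph.D₂₁, Digraph.D₂₂, Digraph.D₂₃},
      G.IsOrientedCograph ∧
        G.IsFree {Digraph.D₁₂, Digraph.D₂₁, Digraph.D₂₂, Digraph.D₂₃},
      G.IsFree {Digraph.D₈, Digraph.biK₂, Digraph.D₁₂, Digraph.D₂₁, Digraph.D₂₂, Digraph.D₂₃} ∧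
        G.IsTransitive] := by
  tfae_have 2 ↔ 4 := Digraph.isFree_iff_isFree_and_isTransitive hG
  tfae_have 1 ↔ 4 := by
    rw [Digraph.isFree_and_isTransitive_iff hG]
    exact ⟨fun h => h.isStrict,
      fun ⟨hs, hN, hX, hC⟩ => hs.isOrientedCoWeaklyQuasiThreshold hN hX hC⟩
  tfae_have 3 ↔ 4 := by
    rw [Digraph.isFree_and_isTransitive_iff hG]
    constructor
    · rintro ⟨hc, h⟩
      exact ⟨hc.isStrict.1, hc.isStrict.2, hc.isStrict.1.isFree_iff.1 h⟩
    · rintro ⟨hs, hN, h⟩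
      exact ⟨hs.isOrientedCograph hN, hs.isFree_iff.2 h⟩
  tfae_finish
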